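/- **Setting.** Let $n\ge 1$, $k\ge 2$, let $q_a$ be a register of $n$ address qubits (numbered $0,\dots,n-1$) and $q_d$ a register of $k$ data qubits. A *super-operator* on a finite-dimensional space is a trace-preserving map $\mathcal E=\sum_j E_j\circ E_j^\dagger:\ \rho\mapsto\sum_j E_j\rho E_j^\dagger$ with $\sum_j E_j^\dagger E_j=I$. For $\mu<\nu$ in $\{0,1\}^k$ (compared as binary numbers), $m\in\{0,\dots,n-1\}$, $x\in\{0,1\}^n$, $b\in\{0,1\}$ put $$U_t(m,x,b)=U_{\mathrm{SWAP}(0,m)}\,Z(x)\,X_0^{b}\,V(\mu,\nu)\,(H^{\otimes n}\otimes I),$$ where $H$ is the Hadamard gate, $V(\mu,\nu)$ maps $|0\rangle|\xi\rangle|\tau\rangle\mapsto|0\rangle|\xi\rangle|\tau\oplus\mu\rangle$ and $|1\rangle|\xi\rangle|\tau\rangle\mapsto|1\rangle|\xi\rangle|\tau\oplus\nu\rangle$ for $\xi\in\{0,1\}^{n-1}$, $\tau\in\{0,1\}^k$; $X_0$ is Pauli $X$ on address qubit $0$; $Z(x)$ applies Pauli $Z$ to the address qubits $j$ with $x_j=1$;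 and $U_{\mathrm{SWAP}(0,m)}$ swaps address qubits $0$ and $m$. In the test procedure *TestBob1*, Alice draws $\mu<\nu$, $m$, $x$, $b$ uniformly at random and then twice does the following: she sends Bob the test state $|\psi\rangle=U_t(m,x,b)|0\rangle^{\otimes(n+k)}$ on $q_a,q_d$; Bob acts and returns $q_a,q_d$; she applies $U_t(m,x,b)^\dagger$ and measures all address and data qubits in the computational basis. Let $v,w\in\{0,1\}^{n+k}$ be the outcomes for the two copies. Bob passes if $v_0=w_0$ and $v_j=w_j=0$ for all $j>0$. In the first copy Bob adds an ancilla $q_{g}$ in a pure state $\theta_1$ and applies a super-operator $\mathcal E_1$ to $q_a,q_d,q_{g}$; in the second copy he adds a new ancilla $q_{g}'$ in a pure state $\theta_2$ and applies a super-operator $\mathcal E_2$ to $q_a,q_d,q_{g}'$ (in particular $\mathcal E_1=\mathcal E_2=\mathcal E$ with $\theta_1=\theta_2=|0\rangle\langle 0|$ is allowed). The ancillas have arbitrary non-zero finite dimensions. **Theorem.** 1. Fix pure states $\theta_1,\theta_2$ (the blank ancilla states). If Bob passes the test with probability $1$, then there are a unitary operator $U$ on $q_a,q_d$ and super-operators $\mathcal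 E_{g,1}$ on $q_g$ and $\mathcal E_{g,2}$ on $q_g'$ such that $\mathcal E_i=U\circ U^\dagger\otimes\mathcal E_{g,i}$ on all inputs with blank ancilla, that is, for every operator $\rho$ on $q_a,q_d$ and $i=1,2$, $$\mathcal E_i(\rho\otimes\theta_i)=U\rho U^\dagger\otimes\mathcal E_{g,i}(\theta_i).$$ 2. If Bob passes the test with probability $1$ for all choices of the pure states $\theta_1,\theta_2$, then there are a unitary $U$ on $q_a,q_d$ and super-operators $\mathcal E_{g,1},\mathcal E_{g,2}$ on the ancillas such that $$\mathcal E_i=U\circ U^\dagger\otimes\mathcal E_{g,i}\qquad(i=1,2)$$ as super-operators. -/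

import Mathlib

open scoped Kronecker Matrix

namespace QTest

noncomputable section

/-- Bit strings of length `n`; bit number `0` is the first (most significant) one. -/
abbrev Bits (n : ℕ) : Type := Fin n → Bool

/-- Labels of the computational basis of `n` address qubits followed by `k` data qubits. -/
abbrev AD (n k : ℕ) : Type := Bits n × Bits k

/-- The number with binary representation `s`. -/
def binaryValue {k : ℕ} (s : Bits k) : ℕ :=
  ∑ j : Fin k, if s j = true then 2 ^ (k - 1 - (j : ℕ)) else 0

/-- Bitwise exclusive or. -/
def bitXor {k : ℕ} (s r : Bits k) : Bits k := fun j => xor (s j) (r j)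

/-! Quantum states and super-operators on the space with orthonormal basis `H`. -/

/-- `θ` is a unit vector. -/
def IsUnitVector {H : Type*} [Fintype H] (θ : H → ℂ) : Prop := star θ ⬝ᵥ θ = 1

/-- The projector `|θ⟩⟨θ|`. -/
def pureState {H : Type*} (θ : H → ℂ) : Matrix H H ℂ := Matrix.vecMulVec θ (star θ)

/-- `Φ = ∑ j, K j ∘ (K j)†` with `∑ j, (K j)† K j = 1`: a (trace-preserving) super-operator. -/
def IsSuperOperator {H : Type*} [Fintype H] [DecidableEq H]
    (Φ : Matrix H H ℂ →ₗ[ℂ] Matrix H H ℂ) : Prop :=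
  ∃ (r : ℕ) (K : Fin r → Matrix H H ℂ),
    (∑ j, (K j)ᴴ * K j = 1) ∧ ∀ ρ, Φ ρ = ∑ j, K j * ρ * (K j)ᴴ

/-! The gates that Alice uses. -/

/-- The operator `|q⟩ ↦ |f q⟩`. -/
def basisMap {H : Type*} [DecidableEq H] (f : H → H) : Matrix H H ℂ :=
  Matrix.of fun p q => if p = f q then 1 else 0

/-- The Hadamard gate on one qubit. -/
def hadamard : Matrix Bool Bool ℂ :=
  Matrix.of fun a b => (if (a && b) = true then -1 else 1) / (Real.sqrt 2 : ℂ)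

/-- `W = H^{⊗ n}`. -/
def hadamardAll (n : ℕ) : Matrix (Bits n) (Bits n) ℂ :=
  Matrix.of fun a b => ∏ j, hadamard (a j) (b j)

/-- `V(μ, ν)`: adds `μ` to the data qubits if the first address qubit is `0`, and `ν` if it
is `1`. -/
def gateV {n k : ℕ} [NeZero n] (μ ν : Bits k) : Matrix (AD n k) (AD n k) ℂ :=
  basisMap fun q => (q.1, bitXor q.2 (if q.1 0 = true then ν else μ))

/-- `X₀ ^ b`: Pauli `X` on the first address qubit if `b = 1`, the identity if `b = 0`. -/
def gateX {n k : ℕ} [NeZero n] (b : Bool) : Matrix (AD n k) (AD n k) ℂ :=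
  basisMap fun q => (Function.update q.1 0 (xor (q.1 0) b), q.2)

/-- `Z(x)`: Pauli `Z` on the address qubits `j` with `x j = 1`. -/
def gateZ {n k : ℕ} (x : Bits n) : Matrix (AD n k) (AD n k) ℂ :=
  Matrix.diagonal fun q => ∏ j, if (x j && q.1 j) = true then -1 else 1

/-- Swaps address qubits number `0` and number `m`. -/
def gateSwap {n k : ℕ} [NeZero n] (m : Fin n) : Matrix (AD n k) (AD n k) ℂ :=
  basisMap fun q => (q.1 ∘ Equiv.swap 0 m, q.2)

/-- Alice's preparation operator
`U_t(m, x, b) = SWAP(0, m) Z(x) X₀ ^ b V(μ, ν) (W ⊗ I)`. -/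
def testUnitary {n k : ℕ} [NeZero n] (m : Fin n) (x : Bits n) (b : Bool) (μ ν : Bits k) :
    Matrix (AD n k) (AD n k) ℂ :=
  gateSwap m * gateZ x * gateX b * gateV μ ν * (hadamardAll n ⊗ₖ (1 : Matrix (Bits k) (Bits k) ℂ))

/-! The test. -/

/-- The basis vector `|0⟩^{⊗ (n + k)}`. -/
def zeroVector (n k : ℕ) : AD n k → ℂ := Pi.single (fun _ => false, fun _ => false) 1

/-- The values `μ < ν`, `m`, `x`, `b` that Alice draws uniformly at random. -/
abbrev Params (n k : ℕ) : Type :=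
  {p : Bits k × Bits k // binaryValue p.1 < binaryValue p.2} × Fin n × Bits n × Bool

/-- The operator `U_t(m, x, b)` for the drawn parameters. -/
def paramUnitary {n k : ℕ} [NeZero n] (s : Params n k) : Matrix (AD n k) (AD n k) ℂ :=
  testUnitary s.2.1 s.2.2.1 s.2.2.2 s.1.1.1 s.1.1.2

/-- The test state `U_t(m, x, b)|0⟩^{⊗ (n + k)}` that Alice sends. -/
def testState {n k : ℕ} [NeZero n] (s : Params n k) : AD n k → ℂ :=
  paramUnitary s *ᵥ zeroVector n k

/-- The joint state of address, data and ancilla qubits at Alice's final measurement of one copy: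
she sends the test state, Bob applies `E` to it and an ancilla in state `θ`, and she applies
`U_t(m, x, b)†` to the address and data qubits. -/
def finalState {n k : ℕ} [NeZero n] {G : Type*} [Fintype G] [DecidableEq G]
    (E : Matrix (AD n k × G) (AD n k × G) ℂ →ₗ[ℂ] Matrix (AD n k × G) (AD n k × G) ℂ)
    (θ : G → ℂ) (s : Params n k) : Matrix (AD n k × G) (AD n k × G) ℂ :=
  ((paramUnitary s)ᴴ ⊗ₖ (1 : Matrix G G ℂ)) * E (pureState (testState s) ⊗ₖ pureState θ) *
    (paramUnitary s ⊗ₖ (1 : Matrix G G ℂ))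

/-- Probability of the outcome `v` when all address and data qubits are measured in the
computational basis. -/
def outcomeProb {n k : ℕ} {G : Type*} [Fintype G] [DecidableEq G]
    (σ : Matrix (AD n k × G) (AD n k × G) ℂ) (v : AD n k) : ℝ :=
  ((pureState (Pi.single v 1) ⊗ₖ (1 : Matrix G G ℂ)) * σ).trace.re

/-- All bits of `v` after the first are `0`. -/
def TailZero {n k : ℕ} [NeZero n] (v : AD n k) : Prop :=
  (∀ j : Fin n, j ≠ 0 → v.1 j = false) ∧ ∀ j : Fin k, v.2 j = false

/-- Alice reports no dishonesty on the outcomes `v` and `w` of the two copies. -/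
def Accepts {n k : ℕ} [NeZero n] (v w : AD n k) : Prop :=
  v.1 0 = w.1 0 ∧ TailZero v ∧ TailZero w

open Classical in
/-- Probability that Bob passes the test when he applies `E₁` to the first copy of the test state
with an ancilla in state `θ₁`, and `E₂` to the second copy with an ancilla in state `θ₂`. -/
def passProbability {n k : ℕ} [NeZero n] {G₁ G₂ : Type*} [Fintype G₁] [DecidableEq G₁]
    [Fintype G₂] [DecidableEq G₂]
    (E₁ : Matrix (AD n k × G₁) (AD n k × G₁) ℂ →ₗ[ℂ] Matrix (AD n k × G₁) (AD n k × G₁) ℂ)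
    (θ₁ : G₁ → ℂ)
    (E₂ : Matrix (AD n k × G₂) (AD n k × G₂) ℂ →ₗ[ℂ] Matrix (AD n k × G₂) (AD n k × G₂) ℂ)
    (θ₂ : G₂ → ℂ) : ℝ :=
  (∑ s : Params n k, ∑ v : AD n k, ∑ w : AD n k,
      if Accepts v w then
        outcomeProb (finalState E₁ θ₁ s) v * outcomeProb (finalState E₂ θ₂ s) w
      else 0) / Fintype.card (Params n k)

end

end QTest

open QTest

/-! ### Alice's gates: unitarity and explicit amplitudes of the test vectors. -/

section Gates

/-! Slice each Kraus operator into blocks `T = (1 ⊗ ⟨g|) K (1 ⊗ θ)` acting on address and data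
alone. For fixed parameters `s` the two copies give independent outcomes, and acceptance forces them
to be equal. Passing surely therefore makes both outcomes one deterministic value `σ s`
(`exists_concentrated`), so every block of both copies sends the test state to a multiple of `U_s|σ
s⟩`: this is `MapsTestStates σ`.

Such operators are rigid. A test state and its possible images are supported on the labels `(a, f (a
m))`, with Walsh amplitudes. Varying `x` and inverting the Walsh matrix kills every entry of `T`
from a label in the support to one outside it; since `k ≥ 2` leaves a spare data string, any two
labels can be separated this way and `T` is diagonal (`MapsTestStates.isDiag`). Within one support
the diagonal entries agree up to signs fixed by `σ`, and supports chain together (`linked`). Hence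
all blocks are multiples of one diagonal unitary `D` determined by `σ`.

For fixed ancilla states the coefficients define the ancilla channel. When all ancilla states pass,
varying one ancilla while keeping the other fixed shows that `D` can be chosen uniformly, and then
`K j = D ⊗ C j`. -/

theorem basisMap_mem_unitary {H : Type*} [Fintype H] [DecidableEq H] {f : H → H}
    (hf : Function.Injective f) : basisMap f ∈ Matrix.unitaryGroup H ℂ := by
  rw [Matrix.mem_unitaryGroup_iff']
  ext p q
  simp [Matrix.mul_apply, basisMap, Matrix.star_apply, Matrix.one_apply, apply_ite,
    hf.eq_iff, Finset.sum_ite_eq', eq_comm (a := q)]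

theorem basisMap_mulVec {H : Type*} [Fintype H] [DecidableEq H] {f : H → H}
    (hf : Function.Involutive f) (φ : H → ℂ) (p : H) : (basisMap f *ᵥ φ) p = φ (f p) := by
  simp only [Matrix.mulVec, dotProduct, basisMap, Matrix.of_apply, ite_mul, one_mul, zero_mul]
  rw [Finset.sum_eq_single (f p)]
  · simp [hf p]
  · intro q _ hq
    rw [if_neg]
    rintro rfl
    exact hq (hf q).symm
  · simp

theorem ofReal_sqrt_two_mul_self : (Real.sqrt 2 : ℂ) * (Real.sqrt 2 : ℂ) = 2 := by
  rw [← Complex.ofReal_mul, Real.mul_self_sqrt (by norm_num)]; norm_num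

theorem hadamard_conjTranspose_mul_self (a b : Bool) :
    ∑ c, star (hadamard c a) * hadamard c b = if a = b then 1 else 0 := by
  have h := ofReal_sqrt_two_mul_self
  have h0 : (Real.sqrt 2 : ℂ) ≠ 0 := by
    intro h0; rw [h0] at h; norm_num at h
  cases a <;> cases b <;> simp [hadamard] <;> field_simp <;> rw [pow_two, h] <;> norm_num

theorem hadamardAll_mem_unitary (n : ℕ) : hadamardAll n ∈ Matrix.unitaryGroup (Bits n) ℂ := by
  rw [Matrix.mem_unitaryGroup_iff']
  ext a b
  simp only [Matrix.mul_apply, Matrix.star_apply, hadamardAll, Matrix.of_apply, star_prod,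
    ← Finset.prod_mul_distrib]
  rw [← Fintype.prod_sum (fun j c => star (hadamard c (a j)) * hadamard c (b j))]
  simp only [hadamard_conjTranspose_mul_self, Matrix.one_apply, funext_iff]
  rw [Finset.prod_ite_zero]
  simp

theorem bitXor_involutive {k : ℕ} (τ : Bits k) : Function.Involutive (fun σ => bitXor σ τ) := by
  intro σ; funext j; simp [bitXor]

theorem gateV_involutive {n k : ℕ} [NeZero n] (μ ν : Bits k) : Function.Involutive
    (fun q : AD n k => (q.1, bitXor q.2 (if q.1 0 = true then ν else μ))) :=
  fun q => Prod.ext rfl (bitXor_involutive _ q.2)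

theorem gateX_involutive {n k : ℕ} [NeZero n] (b : Bool) : Function.Involutive
    (fun q : AD n k => (Function.update q.1 0 (xor (q.1 0) b), q.2)) :=
  fun q => by simp

theorem gateSwap_involutive {n k : ℕ} [NeZero n] (m : Fin n) : Function.Involutive
    (fun q : AD n k => (q.1 ∘ Equiv.swap 0 m, q.2)) :=
  fun q => by ext <;> simp

theorem gateZ_mem_unitary {n k : ℕ} (x : Bits n) :
    (gateZ x : Matrix (AD n k) (AD n k) ℂ) ∈ Matrix.unitaryGroup (AD n k) ℂ := by
  rw [Matrix.mem_unitaryGroup_iff', gateZ, Matrix.star_eq_conjTranspose,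
    Matrix.diagonal_conjTranspose, Matrix.diagonal_mul_diagonal, ← Matrix.diagonal_one]
  congr 1
  funext q
  simp only [Pi.star_apply, star_prod, ← Finset.prod_mul_distrib]
  refine Finset.prod_eq_one fun j _ => ?_
  split_ifs <;> simp

theorem paramUnitary_mem_unitary {n k : ℕ} [NeZero n] (s : Params n k) :
    paramUnitary s ∈ Matrix.unitaryGroup (AD n k) ℂ := by
  refine mul_mem (mul_mem (mul_mem (mul_mem ?_ ?_) ?_) ?_) ?_
  · exact basisMap_mem_unitary (gateSwap_involutive _).injective
  · exact gateZ_mem_unitary _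
  · exact basisMap_mem_unitary (gateX_involutive _).injective
  · exact basisMap_mem_unitary (gateV_involutive _ _).injective
  · exact Matrix.kronecker_mem_unitary (hadamardAll_mem_unitary n) (one_mem _)

theorem hadamardAll_apply {n : ℕ} (a x : Bits n) :
    hadamardAll n a x =
      (∏ j, if (a j && x j) = true then -1 else 1) * ∏ _j : Fin n, (1 / (Real.sqrt 2 : ℂ)) := by
  rw [← Finset.prod_mul_distrib]
  simp only [hadamardAll, hadamard, Matrix.of_apply, mul_one_div]

theorem hadamardAll_apply_ne_zero {n : ℕ} (a x : Bits n) : hadamardAll n a x ≠ 0 := by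
  rw [hadamardAll_apply]
  refine mul_ne_zero (Finset.prod_ne_zero_iff.2 fun j _ => ?_)
    (Finset.prod_ne_zero_iff.2 fun j _ => by simp)
  split_ifs <;> simp

/-- The vectors `U_t(m, x, b)|v⟩` for `v` with trivial data bits. -/
theorem testUnitary_mulVec_single {n k : ℕ} [NeZero n] (m : Fin n) (x : Bits n) (b : Bool)
    (μ ν : Bits k) (v : AD n k) (hv : ∀ j, v.2 j = false) (p : AD n k) :
    (testUnitary m x b μ ν *ᵥ Pi.single v 1) p =
      if p.2 = (if xor (p.1 m) b = true then ν else μ) then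
        (∏ j, if (x j && p.1 (Equiv.swap 0 m j)) = true then -1 else 1) *
          hadamardAll n (Function.update (p.1 ∘ Equiv.swap 0 m) 0 (xor (p.1 m) b)) v.1
      else 0 := by
  rw [testUnitary, ← Matrix.mulVec_mulVec, ← Matrix.mulVec_mulVec,
    ← Matrix.mulVec_mulVec, ← Matrix.mulVec_mulVec, gateSwap,
    basisMap_mulVec (gateSwap_involutive m), gateZ, Matrix.mulVec_diagonal, gateX,
    basisMap_mulVec (gateX_involutive b), gateV, basisMap_mulVec (gateV_involutive μ ν),
    Matrix.mulVec_single_one]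
  have h0 : v.2 = fun _ => false := funext hv
  have h : ∀ σ τ : Bits k, bitXor σ τ = v.2 ↔ σ = τ := by
    intro σ τ
    rw [h0]
    simp [funext_iff, bitXor]
  simp [Matrix.kroneckerMap_apply, Matrix.one_apply, h]

/-- The vectors `U_t(m, x, b)|v⟩` for `v` with all bits after the first one trivial; here `x` is
written in the order of the address qubits after the swap. -/
theorem testUnitary_mulVec_single_of_tailZero {n k : ℕ} [NeZero n] (m : Fin n) (x : Bits n)
    (b : Bool) (μ ν : Bits k) (v : AD n k) (hv : TailZero v) (p : AD n k) :
    (testUnitary m (x ∘ Equiv.swap 0 m) b μ ν *ᵥ Pi.single v 1) p =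
      if p.2 = (if xor (p.1 m) b = true then ν else μ) then
        hadamardAll n p.1 x * (if (xor (p.1 m) b && v.1 0) = true then -1 else 1)
      else 0 := by
  rw [testUnitary_mulVec_single _ _ _ _ _ _ hv.2]
  refine if_congr Iff.rfl ?_ rfl
  have h1 : (∏ j, if ((x ∘ Equiv.swap 0 m) j && p.1 (Equiv.swap 0 m j)) = true then (-1 : ℂ)
      else 1) = ∏ j, if (p.1 j && x j) = true then -1 else 1 := by
    rw [← Equiv.prod_comp (Equiv.swap 0 m)
      fun j => if (p.1 j && x j) = true then (-1 : ℂ) else 1]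
    simp only [Function.comp_apply, Bool.and_comm]
  -- All bits of `v` after the first vanish, so only the factor at position `0` survives.
  have h2 : (∏ j, if ((Function.update (p.1 ∘ Equiv.swap 0 m) 0 (xor (p.1 m) b)) j && v.1 j) = true
      then (-1 : ℂ) else 1) = if (xor (p.1 m) b && v.1 0) = true then -1 else 1 := by
    rw [Finset.prod_eq_single (0 : Fin n) (fun j _ hj => by simp [hv.1 j hj]) (by simp),
      Function.update_self]
  rw [h1, hadamardAll_apply, hadamardAll_apply, h2]
  ring

/-- Sums of distinct powers of two determine the set of exponents. This lets any two different data
strings occur as `μ` and `ν`. -/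
theorem binaryValue_injective (k : ℕ) : Function.Injective (binaryValue (k := k)) := by
  intro s t h
  have hinj : Function.Injective fun j : Fin k => k - 1 - (j : ℕ) := by
    intro i j hij
    apply Fin.ext
    have := i.2
    have := j.2
    simp only at hij
    omega
  have key : ∀ s : Bits k, binaryValue s =
      ∑ i ∈ (Finset.univ.filter fun j => s j = true).map ⟨_, hinj⟩, 2 ^ i := by
    intro s
    rw [Finset.sum_map, Finset.sum_filter]
    rfl
  rw [key, key] at h
  have h2 := Finset.map_injective _ (Finset.geomSum_injective le_rfl h)
  funext j
  have h3 := Finset.ext_iff.1 h2 j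
  simp only [Finset.mem_filter, Finset.mem_univ, true_and] at h3
  exact Bool.eq_iff_iff.2 h3

/-- For two different data strings `f 0` and `f 1` and each `m`, `x` there is a test whose state is
supported on the labels `(a, f (a m))`. -/
theorem exists_params {n k : ℕ} [NeZero n] (m : Fin n) {f : Bool → Bits k}
    (hf : f false ≠ f true) (x : Bits n) : ∃ (b : Bool) (s : Params n k), ∀ v, TailZero v → ∀ p,
      (paramUnitary s *ᵥ Pi.single v 1) p =
        if p.2 = f (p.1 m) then
          hadamardAll n p.1 x * (if (xor (p.1 m) b && v.1 0) = true then -1 else 1)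
        else 0 := by
  -- The smaller string has to play the role of `μ`; the flip `b` restores the order prescribed by
  -- `f`.
  rcases lt_or_gt_of_ne ((binaryValue_injective k).ne hf) with h | h
  · refine ⟨false, ⟨⟨(_, _), h⟩, m, x ∘ Equiv.swap 0 m, false⟩, fun v hv p => ?_⟩
    rw [paramUnitary, testUnitary_mulVec_single_of_tailZero _ _ _ _ _ _ hv]
    cases p.1 m <;> rfl
  · refine ⟨true, ⟨⟨(_, _), h⟩, m, x ∘ Equiv.swap 0 m, true⟩, fun v hv p => ?_⟩
    rw [paramUnitary, testUnitary_mulVec_single_of_tailZero _ _ _ _ _ _ hv]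
    cases p.1 m <;> rfl

end Gates

/-! ### Kraus blocks at a fixed ancilla state, and outcome probabilities. -/

section Blocks

/-- The isometry `φ ↦ φ ⊗ θ`. -/
noncomputable def adjoinVector (A : Type*) {G : Type*} [DecidableEq A] (θ : G → ℂ) :
    Matrix (A × G) A ℂ :=
  Matrix.of fun p q => if p.1 = q then θ p.2 else 0

theorem adjoinVector_conj {A G : Type*} [Fintype A] [DecidableEq A] (θ : G → ℂ) (ρ : Matrix A A ℂ) :
    adjoinVector A θ * ρ * (adjoinVector A θ)ᴴ = ρ ⊗ₖ pureState θ := by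
  ext ⟨p, g⟩ ⟨q, h⟩
  simp [Matrix.mul_apply, adjoinVector, pureState, Matrix.vecMulVec_apply, apply_ite]
  ring

theorem adjoinVector_isometry {A G : Type*} [Fintype A] [DecidableEq A] [Fintype G] {θ : G → ℂ} (hθ : IsUnitVector θ) :
    (adjoinVector A θ)ᴴ * adjoinVector A θ = 1 := by
  ext p q
  simp only [IsUnitVector, dotProduct, Pi.star_apply] at hθ
  simp only [Matrix.mul_apply, Matrix.conjTranspose_apply, adjoinVector, Matrix.of_apply,
    Fintype.sum_prod_type, apply_ite star, star_zero, ite_mul, zero_mul, mul_ite, mul_zero,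
    Matrix.one_apply]
  rw [Finset.sum_eq_single p]
  · by_cases h : p = q <;> simp [h, ← hθ]
  · intro r _ hr; simp [hr]
  · simp

variable {A G : Type*} [Fintype A] [DecidableEq A] [Fintype G] [DecidableEq G]

/-- The operator `φ ↦ (1 ⊗ ⟨g|) K (φ ⊗ θ)`. -/
noncomputable def ancillaBlock (K : Matrix (A × G) (A × G) ℂ) (θ : G → ℂ) (g : G) : Matrix A A ℂ :=
  (K * adjoinVector A θ).submatrix (fun p => (p, g)) id

theorem ancillaBlock_single (K : Matrix (A × G) (A × G) ℂ) (g h : G) (p q : A) :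
    ancillaBlock K (Pi.single h 1) g p q = K (p, g) (q, h) := by
  simp [ancillaBlock, Matrix.mul_apply, adjoinVector, Fintype.sum_prod_type, Pi.single_apply,
    ← ite_and]
  rw [Finset.sum_eq_single q, Finset.sum_eq_single h] <;> simp +contextual

theorem isUnitVector_single (g : G) : IsUnitVector (Pi.single g 1 : G → ℂ) := by
  simp [IsUnitVector]

/-- Compress `∑ K† K = 1` by the isometry `φ ↦ φ ⊗ θ`; the sum over `g` is the ancilla part of the
matrix product. -/
theorem sum_conjTranspose_ancillaBlock_mul {r : ℕ} {K : Fin r → Matrix (A × G) (A × G) ℂ}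
    (hK : ∑ j, (K j)ᴴ * K j = 1) {θ : G → ℂ} (hθ : IsUnitVector θ) :
    ∑ j, ∑ g, (ancillaBlock (K j) θ g)ᴴ * ancillaBlock (K j) θ g = 1 := by
  have h : ∀ j, ∑ g, (ancillaBlock (K j) θ g)ᴴ * ancillaBlock (K j) θ g =
      (adjoinVector A θ)ᴴ * ((K j)ᴴ * K j) * adjoinVector A θ := by
    intro j
    have : (adjoinVector A θ)ᴴ * ((K j)ᴴ * K j) * adjoinVector A θ =
        (K j * adjoinVector A θ)ᴴ * (K j * adjoinVector A θ) := by
      simp only [Matrix.conjTranspose_mul, Matrix.mul_assoc]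
    rw [this]
    ext p q
    simp only [Matrix.sum_apply, Matrix.mul_apply (M := (K j * adjoinVector A θ)ᴴ),
      Fintype.sum_prod_type]
    rw [Finset.sum_comm]
    refine Finset.sum_congr rfl fun g _ => ?_
    rw [Matrix.mul_apply]
    rfl
  rw [Finset.sum_congr rfl fun j _ => h j, ← Matrix.sum_mul, ← Matrix.mul_sum, hK, Matrix.mul_one,
    adjoinVector_isometry hθ]

theorem superOperator_apply_kronecker {A G : Type*} [Fintype A] [DecidableEq A]
    [Fintype G] {r : ℕ} {K : Fin r → Matrix (A × G) (A × G) ℂ}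
    {E : Matrix (A × G) (A × G) ℂ →ₗ[ℂ] Matrix (A × G) (A × G) ℂ}
    (hE : ∀ ρ, E ρ = ∑ j, K j * ρ * (K j)ᴴ) (θ : G → ℂ) (ρ : Matrix A A ℂ) (p q : A) (g h : G) :
    E (ρ ⊗ₖ pureState θ) (p, g) (q, h) =
      ∑ j, (ancillaBlock (K j) θ g * ρ * (ancillaBlock (K j) θ h)ᴴ) p q := by
  rw [hE, Matrix.sum_apply]
  refine Finset.sum_congr rfl fun j _ => ?_
  have : K j * ρ ⊗ₖ pureState θ * (K j)ᴴ =
      (K j * adjoinVector A θ) * ρ * (K j * adjoinVector A θ)ᴴ := by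
    simp only [← adjoinVector_conj, Matrix.conjTranspose_mul, Matrix.mul_assoc]
  rw [this]
  rfl

/-- Total probability is conserved: `Uᴴ` preserves norms and the blocks satisfy the completeness
relation. -/
theorem sum_norm_sq_ancillaBlock {r : ℕ} {K : Fin r → Matrix (A × G) (A × G) ℂ}
    (hK : ∑ j, (K j)ᴴ * K j = 1) {θ : G → ℂ} (hθ : IsUnitVector θ)
    {U : Matrix A A ℂ} (hU : U ∈ Matrix.unitaryGroup A ℂ) (φ : A → ℂ) :
    ∑ v, ∑ j, ∑ g, ‖(Uᴴ *ᵥ (ancillaBlock (K j) θ g *ᵥ φ)) v‖ ^ 2 = ∑ v, ‖φ v‖ ^ 2 := by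
  have key : ∀ ψ : A → ℂ, ((∑ v, ‖ψ v‖ ^ 2 : ℝ) : ℂ) = star ψ ⬝ᵥ ψ := by
    intro ψ
    simp [dotProduct, ← Complex.conj_mul']
  rw [← Complex.ofReal_inj, key φ, Finset.sum_comm]
  simp_rw [Finset.sum_comm (γ := A), Complex.ofReal_sum]
  have hB : ∀ B : Matrix A A ℂ, star (Uᴴ *ᵥ (B *ᵥ φ)) ⬝ᵥ (Uᴴ *ᵥ (B *ᵥ φ)) =
      star φ ⬝ᵥ ((Bᴴ * B) *ᵥ φ) := by
    intro B
    have h1 : U * Uᴴ = 1 := Matrix.mem_unitaryGroup_iff.1 hU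
    rw [Matrix.star_mulVec, Matrix.conjTranspose_conjTranspose, ← Matrix.dotProduct_mulVec,
      Matrix.mulVec_mulVec _ U, h1, Matrix.one_mulVec, Matrix.star_mulVec,
      ← Matrix.dotProduct_mulVec, Matrix.mulVec_mulVec]
  have h2 : ∀ j g, ∑ v, (((‖(Uᴴ *ᵥ (ancillaBlock (K j) θ g *ᵥ φ)) v‖ ^ 2 : ℝ)) : ℂ) =
      star φ ⬝ᵥ (((ancillaBlock (K j) θ g)ᴴ * ancillaBlock (K j) θ g) *ᵥ φ) := by
    intro j g
    rw [← hB, ← key, Complex.ofReal_sum]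
  simp_rw [h2, ← dotProduct_sum, ← Matrix.sum_mulVec]
  rw [sum_conjTranspose_ancillaBlock_mul hK hθ, Matrix.one_mulVec]

theorem trace_pureState_kronecker_one_mul (v : A) (B : Matrix (A × G) (A × G) ℂ) :
    ((pureState (Pi.single v 1) ⊗ₖ (1 : Matrix G G ℂ)) * B).trace = ∑ g, B (v, g) (v, g) := by
  simp only [Matrix.trace, Matrix.diag, Matrix.mul_apply, Fintype.sum_prod_type,
    Matrix.kroneckerMap_apply, pureState, Matrix.vecMulVec_apply, Pi.single_apply,
    Matrix.one_apply, Pi.star_apply, apply_ite star, star_one, star_zero, mul_ite, ite_mul,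
    mul_one, one_mul, mul_zero, zero_mul]
  rw [Finset.sum_eq_single v]
  · simp
  · intro p _ hp; simp [hp]
  · simp

theorem kronecker_one_mul_mul_kronecker_one_apply {A G : Type*} [Fintype A] [Fintype G]
    [DecidableEq G] (B C : Matrix A A ℂ)
    (X : Matrix (A × G) (A × G) ℂ) (u v : A) (g : G) :
    ((B ⊗ₖ (1 : Matrix G G ℂ)) * X * (C ⊗ₖ (1 : Matrix G G ℂ))) (u, g) (v, g) =
      ∑ q, (∑ p, B u p * X (p, g) (q, g)) * C q v := by
  simp only [Matrix.mul_apply, Fintype.sum_prod_type, Matrix.kroneckerMap_apply,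
    Matrix.one_apply, mul_ite, ite_mul, mul_one, mul_zero, zero_mul, Finset.sum_ite_eq,
    Finset.sum_ite_eq', Finset.mem_univ, if_true]

/-- In this form a vanishing probability forces the amplitude of every single block to vanish. -/
theorem outcomeProb_finalState {n k : ℕ} [NeZero n] {r : ℕ}
    {K : Fin r → Matrix (AD n k × G) (AD n k × G) ℂ}
    {E : Matrix (AD n k × G) (AD n k × G) ℂ →ₗ[ℂ] Matrix (AD n k × G) (AD n k × G) ℂ}
    (hE : ∀ ρ, E ρ = ∑ j, K j * ρ * (K j)ᴴ) (θ : G → ℂ) (s : Params n k) (v : AD n k) :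
    outcomeProb (finalState E θ s) v =
      ∑ j, ∑ g, ‖((paramUnitary s)ᴴ *ᵥ (ancillaBlock (K j) θ g *ᵥ testState s)) v‖ ^ 2 := by
  set U := paramUnitary s
  set ψ := testState s
  have h2 : ∀ g, finalState E θ s (v, g) (v, g) = ∑ j,
      (((‖(Uᴴ *ᵥ (ancillaBlock (K j) θ g *ᵥ ψ)) v‖ ^ 2 : ℝ)) : ℂ) := by
    intro g
    have h4 : ∀ B : Matrix (AD n k) (AD n k) ℂ, (((‖(Uᴴ *ᵥ (B *ᵥ ψ)) v‖ ^ 2 : ℝ)) : ℂ) =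
        (Uᴴ * (B * pureState ψ * Bᴴ) * U) v v := by
      intro B
      have : Uᴴ * (B * pureState ψ * Bᴴ) * U =
          Matrix.vecMulVec (Uᴴ *ᵥ (B *ᵥ ψ)) (star (Uᴴ *ᵥ (B *ᵥ ψ))) := by
        simp only [pureState, Matrix.mul_vecMulVec, Matrix.vecMulVec_mul, Matrix.star_mulVec,
          Matrix.conjTranspose_conjTranspose]
      rw [this, Matrix.vecMulVec_apply, Pi.star_apply, Complex.star_def, Complex.mul_conj']
      norm_cast
    simp_rw [h4]
    rw [finalState, kronecker_one_mul_mul_kronecker_one_apply, ← Matrix.sum_apply, ← Finset.sum_mul, ← Finset.mul_sum, Matrix.mul_apply]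
    simp only [Matrix.mul_apply (M := Uᴴ), Matrix.sum_apply, superOperator_apply_kronecker hE]
    rfl
  rw [outcomeProb, trace_pureState_kronecker_one_mul]
  simp_rw [h2]
  rw [Finset.sum_comm]
  simp only [Complex.re_sum, Complex.ofReal_re]

end Blocks

/-! ### From passing surely to deterministic outcomes. -/

section Probability

/-- If two independent outcomes almost surely satisfy a relation contained in equality, then both
are almost surely equal to the same fixed value. -/
theorem exists_concentrated {ι : Type*} [Fintype ι] {R : ι → ι → Prop} [DecidableRel R]
    (hR : ∀ v w, R v w → v = w) {p q : ι → ℝ} (hp : ∀ v, 0 ≤ p v) (hq : ∀ v, 0 ≤ q v)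
    (hp1 : ∑ v, p v = 1) (hq1 : ∑ v, q v = 1)
    (h : ∑ v, ∑ w, (if R v w then p v * q w else 0) = 1) :
    ∃ w, R w w ∧ (∀ v, v ≠ w → p v = 0) ∧ ∀ v, v ≠ w → q v = 0 := by
  have hall : ∑ v, ∑ w, p v * q w = 1 := by
    simp_rw [← Finset.mul_sum, hq1, mul_one, hp1]
  have hle : ∀ v w, (if R v w then p v * q w else 0) ≤ p v * q w := by
    intro v w
    split_ifs
    · exact le_rfl
    · exact mul_nonneg (hp v) (hq w)
  -- Both double sums equal `1`, so the termwise inequality is an equality throughout.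
  have heq : ∀ v w, (if R v w then p v * q w else 0) = p v * q w := by
    have h1 := (Finset.sum_eq_sum_iff_of_le
      (fun v (_ : v ∈ Finset.univ) => Finset.sum_le_sum fun w _ => hle v w)).1 (h.trans hall.symm)
    intro v w
    exact (Finset.sum_eq_sum_iff_of_le (fun w _ => hle v w)).1 (h1 v (Finset.mem_univ v)) w
      (Finset.mem_univ w)
  have hzero : ∀ v w, ¬ R v w → p v = 0 ∨ q w = 0 := by
    intro v w hvw
    have := heq v w
    rw [if_neg hvw] at this
    exact mul_eq_zero.1 this.symm
  obtain ⟨w, -, hw⟩ : ∃ w ∈ Finset.univ, q w ≠ 0 :=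
    Finset.exists_ne_zero_of_sum_ne_zero (by rw [hq1]; exact one_ne_zero)
  obtain ⟨v, -, hv⟩ : ∃ v ∈ Finset.univ, p v ≠ 0 :=
    Finset.exists_ne_zero_of_sum_ne_zero (by rw [hp1]; exact one_ne_zero)
  have hvw : R v w := by
    by_contra hvw
    exact (hzero v w hvw).elim hv hw
  obtain rfl := hR v w hvw
  refine ⟨v, hvw, fun u hu => ?_, fun u hu => ?_⟩
  · exact (hzero u v fun hr => hu (hR _ _ hr)).resolve_right hw
  · exact (hzero v u fun hr => hu (hR _ _ hr).symm).resolve_left hv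

theorem forall_eq_one_of_average {ι : Type*} [Fintype ι] {f : ι → ℝ} (hf : ∀ s, f s ≤ 1)
    (h : (∑ s, f s) / Fintype.card ι = 1) (s : ι) : f s = 1 := by
  -- Over an empty index type the average is `0` by the convention for division, contradicting `h`.
  have hc : (Fintype.card ι : ℝ) ≠ 0 := by
    intro hc
    rw [hc, div_zero] at h
    exact zero_ne_one h
  have h2 : ∑ s, f s = ∑ _s : ι, (1 : ℝ) := by
    rw [(div_eq_one_iff_eq hc).1 h]; simp
  exact (Finset.sum_eq_sum_iff_of_le fun s _ => hf s).1 h2 s (Finset.mem_univ s)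

theorem Accepts.eq {n k : ℕ} [NeZero n] {v w : AD n k} (h : Accepts v w) : v = w := by
  obtain ⟨h0, ⟨hv, hv'⟩, hw, hw'⟩ := h
  refine Prod.ext (funext fun j => ?_) (funext fun j => (hv' j).trans (hw' j).symm)
  by_cases hj : j = 0
  · rw [hj, h0]
  · rw [hv j hj, hw j hj]

variable {n k : ℕ} [NeZero n]

theorem sum_norm_sq_testState (s : Params n k) : ∑ v, ‖testState s v‖ ^ 2 = 1 := by
  have h1 : ((∑ v, ‖testState s v‖ ^ 2 : ℝ) : ℂ) = star (testState s) ⬝ᵥ testState s := by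
    simp [dotProduct, ← Complex.conj_mul']
  have h2 : (paramUnitary s)ᴴ * paramUnitary s = 1 :=
    Matrix.mem_unitaryGroup_iff'.1 (paramUnitary_mem_unitary s)
  rw [← Complex.ofReal_inj, h1, testState, Matrix.star_mulVec, ← Matrix.dotProduct_mulVec,
    Matrix.mulVec_mulVec, h2, Matrix.one_mulVec, zeroVector]
  simp

/-- `T` maps each test state to a multiple of `U_t(m, x, b)|σ⟩`. -/
def MapsTestStates (σ : Params n k → AD n k) (T : Matrix (AD n k) (AD n k) ℂ) : Prop :=
  ∀ s, ∃ c : ℂ, T *ᵥ testState s = c • (paramUnitary s *ᵥ Pi.single (σ s) 1)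

theorem mulVec_eq_smul_of_forall_ne {A : Type*} [Fintype A] [DecidableEq A] {U : Matrix A A ℂ}
    (hU : U ∈ Matrix.unitaryGroup A ℂ) {φ : A → ℂ} {w : A} (h : ∀ v, v ≠ w → (Uᴴ *ᵥ φ) v = 0) :
    φ = (Uᴴ *ᵥ φ) w • (U *ᵥ Pi.single w 1) := by
  have h1 : Uᴴ *ᵥ φ = (Uᴴ *ᵥ φ) w • Pi.single w 1 := by
    funext v
    by_cases hv : v = w
    · subst hv; simp
    · simp [h v hv, hv]
  have h2 : U * Uᴴ = 1 := Matrix.mem_unitaryGroup_iff.1 hU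
  rw [← Matrix.mulVec_smul, ← h1, Matrix.mulVec_mulVec, h2, Matrix.one_mulVec]

theorem eq_zero_of_sum_sum_norm_sq_eq_zero {ι κ : Type*} [Fintype ι] [Fintype κ] {f : ι → κ → ℂ}
    (hf : ∑ j, ∑ g, ‖f j g‖ ^ 2 = 0) (j : ι) (g : κ) : f j g = 0 := by
  have h1 := (Finset.sum_eq_zero_iff_of_nonneg (fun j _ => by positivity)).1 hf j
    (Finset.mem_univ j)
  have h2 := (Finset.sum_eq_zero_iff_of_nonneg (fun g _ => by positivity)).1 h1 g
    (Finset.mem_univ g)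
  exact norm_eq_zero.1 (pow_eq_zero_iff two_ne_zero |>.1 h2)

/-- An average of probabilities equal to `1` makes each of them `1`, and `exists_concentrated` then
applies for each `s`. Both copies get the same `σ`, which is what later gives them the same unitary.
-/
theorem exists_mapsTestStates_of_passProbability_eq_one {G₁ G₂ : Type*}
    [Fintype G₁] [DecidableEq G₁] [Fintype G₂] [DecidableEq G₂] {r₁ r₂ : ℕ}
    {E₁ : Matrix (AD n k × G₁) (AD n k × G₁) ℂ →ₗ[ℂ] Matrix (AD n k × G₁) (AD n k × G₁) ℂ}
    {E₂ : Matrix (AD n k × G₂) (AD n k × G₂) ℂ →ₗ[ℂ] Matrix (AD n k × G₂) (AD n k × G₂) ℂ}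
    {K₁ : Fin r₁ → Matrix (AD n k × G₁) (AD n k × G₁) ℂ} (hK₁ : ∑ j, (K₁ j)ᴴ * K₁ j = 1)
    (hE₁ : ∀ ρ, E₁ ρ = ∑ j, K₁ j * ρ * (K₁ j)ᴴ)
    {K₂ : Fin r₂ → Matrix (AD n k × G₂) (AD n k × G₂) ℂ} (hK₂ : ∑ j, (K₂ j)ᴴ * K₂ j = 1)
    (hE₂ : ∀ ρ, E₂ ρ = ∑ j, K₂ j * ρ * (K₂ j)ᴴ)
    {θ₁ : G₁ → ℂ} {θ₂ : G₂ → ℂ} (hθ₁ : IsUnitVector θ₁) (hθ₂ : IsUnitVector θ₂)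
    (h : passProbability E₁ θ₁ E₂ θ₂ = 1) :
    ∃ σ : Params n k → AD n k, (∀ s, TailZero (σ s)) ∧
      (∀ j g, MapsTestStates σ (ancillaBlock (K₁ j) θ₁ g)) ∧
      ∀ j g, MapsTestStates σ (ancillaBlock (K₂ j) θ₂ g) := by
  classical
  set p := fun s => outcomeProb (finalState E₁ θ₁ s) with hp
  set q := fun s => outcomeProb (finalState E₂ θ₂ s) with hq
  have hp' : ∀ s v, p s v = _ := fun s v => outcomeProb_finalState hE₁ θ₁ s v
  have hq' : ∀ s v, q s v = _ := fun s v => outcomeProb_finalState hE₂ θ₂ s v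
  have hp0 : ∀ s v, 0 ≤ p s v := fun s v => by rw [hp']; positivity
  have hq0 : ∀ s v, 0 ≤ q s v := fun s v => by rw [hq']; positivity
  have hp1 : ∀ s, ∑ v, p s v = 1 := fun s => by
    simp_rw [hp']
    rw [sum_norm_sq_ancillaBlock hK₁ hθ₁ (paramUnitary_mem_unitary s), sum_norm_sq_testState]
  have hq1 : ∀ s, ∑ v, q s v = 1 := fun s => by
    simp_rw [hq']
    rw [sum_norm_sq_ancillaBlock hK₂ hθ₂ (paramUnitary_mem_unitary s), sum_norm_sq_testState]
  have hs : ∀ s, ∑ v, ∑ w, (if Accepts v w then p s v * q s w else 0) = 1 := by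
    refine forall_eq_one_of_average (fun s => ?_) (by rw [← h, passProbability])
    calc ∑ v, ∑ w, (if Accepts v w then p s v * q s w else 0)
        ≤ ∑ v, ∑ w, p s v * q s w := by
          refine Finset.sum_le_sum fun v _ => Finset.sum_le_sum fun w _ => ?_
          split_ifs
          · exact le_rfl
          · exact mul_nonneg (hp0 s v) (hq0 s w)
      _ = 1 := by simp_rw [← Finset.mul_sum, hq1, mul_one, hp1]
  choose σ hσ hσp hσq using fun s => exists_concentrated (fun v w => Accepts.eq)
    (hp0 s) (hq0 s) (hp1 s) (hq1 s) (hs s)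
  refine ⟨σ, fun s => (hσ s).2.1, fun j g s => ⟨_, mulVec_eq_smul_of_forall_ne
    (paramUnitary_mem_unitary s) fun v hv => ?_⟩, fun j g s => ⟨_, mulVec_eq_smul_of_forall_ne
    (paramUnitary_mem_unitary s) fun v hv => ?_⟩⟩
  · have h1 := hσp s v hv
    rw [hp'] at h1
    exact eq_zero_of_sum_sum_norm_sq_eq_zero h1 j g
  · have h1 := hσq s v hv
    rw [hq'] at h1
    exact eq_zero_of_sum_sum_norm_sq_eq_zero h1 j g

end Probability

/-! ### Rigidity of operators compatible with the test states. -/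

section Rigidity

theorem mulVec_apply_of_support {n k : ℕ} {T : Matrix (AD n k) (AD n k) ℂ} {f : Bits n → Bits k}
    {w : Bits n → ℂ} {φ : AD n k → ℂ}
    (hφ : ∀ p, φ p = if p.2 = f p.1 then w p.1 else 0) (p : AD n k) :
    (T *ᵥ φ) p = ∑ a, T p (a, f a) * w a := by
  simp [Matrix.mulVec, dotProduct, hφ, Fintype.sum_prod_type]

variable {n k : ℕ} [NeZero n]

/-- There are at least four data strings; this is how `k ≥ 2` enters. -/
theorem exists_ne_ne (hk : 2 ≤ k) (μ ν : Bits k) : ∃ κ, κ ≠ μ ∧ κ ≠ ν := by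
  have h : ({μ, ν} : Finset (Bits k)).card < (Finset.univ : Finset (Bits k)).card := by
    refine Finset.card_le_two.trans_lt ?_
    simp only [Finset.card_univ, Fintype.card_pi, Fintype.card_bool, Finset.prod_const,
      Fintype.card_fin]
    exact (by norm_num : 2 < 2 ^ 2).trans_le (Nat.pow_le_pow_right (by norm_num) hk)
  obtain ⟨κ, -, hκ⟩ := Finset.exists_mem_notMem_of_card_lt_card h
  exact ⟨κ, by simpa using hκ⟩

theorem exists_boolFun {X : Type*} (c : Bool) {τ α : X} (h : α ≠ τ) :
    ∃ f : Bool → X, f false ≠ f true ∧ f c = τ ∧ f (!c) = α := by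
  cases c
  · exact ⟨fun a => if a = true then α else τ, by simpa using h.symm, by simp, by simp⟩
  · exact ⟨fun a => if a = true then τ else α, by simpa using h, by simp, by simp⟩

variable {σ : Params n k → AD n k} {T : Matrix (AD n k) (AD n k) ℂ}

theorem tailZero_zero : TailZero ((fun _ => false, fun _ => false) : AD n k) :=
  ⟨fun _ _ => rfl, fun _ => rfl⟩

/-- The image of each test state with this `m` and `f` vanishes at `p`. Over all `x` this says that
row `p` of `T`, restricted to the support, is orthogonal to every Walsh column, hence zero. -/
theorem MapsTestStates.apply_eq_zero (hσ : ∀ s, TailZero (σ s)) (hT : MapsTestStates σ T)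
    (m : Fin n) {f : Bool → Bits k} (hf : f false ≠ f true) {p : AD n k} (hp : p.2 ≠ f (p.1 m))
    (a : Bits n) : T p (a, f (a m)) = 0 := by
  have h1 : (fun a => T p (a, f (a m))) ᵥ* hadamardAll n = 0 := by
    funext x
    obtain ⟨b, s, hs⟩ := exists_params m hf x
    obtain ⟨c, hc⟩ := hT s
    have h2 := congrFun hc p
    rw [Pi.smul_apply, hs _ (hσ s), if_neg hp, smul_zero, testState, zeroVector,
      mulVec_apply_of_support (f := fun a => f (a m)) (w := fun a => hadamardAll n a x)] at h2
    · exact h2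
    · intro q
      rw [hs _ tailZero_zero]
      simp
  have h3 : hadamardAll n * star (hadamardAll n) = 1 :=
    Matrix.mem_unitaryGroup_iff.1 (hadamardAll_mem_unitary n)
  have h4 := congrArg (fun v => v ᵥ* star (hadamardAll n)) h1
  simp only [Matrix.vecMul_vecMul, h3, Matrix.vecMul_one, Matrix.zero_vecMul] at h4
  exact congrFun h4 a

/-- It suffices to find `m` and `f` whose support contains `q` but not `p`. Take `f (q.1 m) = q.2`
and let the other value be a string `α` different from both `p.2` and `q.2`. -/
theorem MapsTestStates.isDiag (hk : 2 ≤ k) (hσ : ∀ s, TailZero (σ s)) (hT : MapsTestStates σ T)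
    {p q : AD n k} (hpq : p ≠ q) : T p q = 0 := by
  obtain ⟨α, hαp, hαq⟩ := exists_ne_ne hk p.2 q.2
  have key : ∀ m, (p.1 m = q.1 m → p.2 ≠ q.2) → T p q = 0 := by
    intro m hm
    obtain ⟨f, hf, hf1, hf2⟩ := exists_boolFun (q.1 m) hαq
    have h := hT.apply_eq_zero hσ m hf (p := p) (a := q.1) ?_
    · rwa [hf1] at h
    · by_cases h : p.1 m = q.1 m
      · rw [h, hf1]; exact hm h
      · rw [Bool.eq_not_of_ne h, hf2]; exact hαp.symm
  by_cases h : p.1 = q.1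
  -- With equal addresses the data strings differ, so any `m` works; otherwise `m` is an address bit
  -- where the labels differ.
  · exact key 0 fun _ h2 => hpq (Prod.ext h h2)
  · obtain ⟨m, hm⟩ := Function.ne_iff.1 h
    exact key m fun h2 => absurd h2 hm

/-- The diagonal entries of all admissible operators at `p` and `q` agree up to a fixed phase. -/
def Linked (σ : Params n k → AD n k) (p q : AD n k) : Prop :=
  ∃ d : ℂ, star d * d = 1 ∧ ∀ T, MapsTestStates σ T → T p p = d * T q q

theorem Linked.trans {p q r : AD n k} (h₁ : Linked σ p q) (h₂ : Linked σ q r) : Linked σ p r := by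
  obtain ⟨d, hd, h⟩ := h₁
  obtain ⟨e, he, h'⟩ := h₂
  refine ⟨d * e, ?_, fun T hT => by rw [h T hT, h' T hT, mul_assoc]⟩
  rw [star_mul, mul_assoc, ← mul_assoc (star d), hd, one_mul, he]

/-- Both labels lie in the support of one test state with `m = 0`. As `T` is diagonal, comparing
coordinates makes each diagonal entry there a common scalar times a sign that depends only on `σ s`.
-/
theorem linked_of_ne_of_ne (hk : 2 ≤ k) (hσ : ∀ s, TailZero (σ s)) {p q : AD n k}
    (h₁ : p.1 0 ≠ q.1 0) (h₂ : p.2 ≠ q.2) : Linked σ p q := by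
  obtain ⟨f, hf, hfq, hfp⟩ := exists_boolFun (q.1 0) h₂
  rw [← Bool.eq_not_of_ne h₁] at hfp
  obtain ⟨b, s, hs⟩ := exists_params 0 hf (fun _ : Fin n => false)
  set e : AD n k → ℂ := fun u => if (xor (u.1 0) b && (σ s).1 0) = true then -1 else 1 with he
  have hee : ∀ u, star (e u) = e u ∧ e u * e u = 1 := by
    intro u
    simp only [he]
    split_ifs <;> simp
  refine ⟨e p * e q, ?_, fun T hT => ?_⟩
  · rw [star_mul, (hee p).1, (hee q).1, mul_assoc, ← mul_assoc (e p), (hee p).2, one_mul,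
      (hee q).2]
  · obtain ⟨c, hc⟩ := hT s
    have key : ∀ u : AD n k, u.2 = f (u.1 0) → T u u = c * e u := by
      intro u hu
      have h := congrFun hc u
      rw [Matrix.mulVec, dotProduct, Finset.sum_eq_single u
        (fun v _ hv => by rw [hT.isDiag hk hσ hv.symm, zero_mul]) (by simp), Pi.smul_apply,
        hs _ (hσ s), if_pos hu, testState, zeroVector, hs _ tailZero_zero, if_pos hu,
        smul_eq_mul] at h
      -- The Walsh amplitude occurs in both the test state and its image, and is nonzero.
      refine mul_right_cancel₀ (hadamardAll_apply_ne_zero u.1 fun _ => false) ?_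
      simp only [Bool.and_false, Bool.false_eq_true, if_false, mul_one] at h
      rw [h]
      ring
    rw [key p hfp.symm, key q hfq.symm, mul_assoc, mul_left_comm (e q), (hee q).2, mul_one, mul_comm]

/-- Labels with equal first bit are joined through a label with the opposite first bit and a third
data string; the remaining case first changes only the data. -/
theorem linked (hk : 2 ≤ k) (hσ : ∀ s, TailZero (σ s)) (p q : AD n k) : Linked σ p q := by
  have key : ∀ p q : AD n k, p.1 0 = q.1 0 → Linked σ p q := by
    intro p q h
    obtain ⟨κ, hκp, hκq⟩ := exists_ne_ne hk p.2 q.2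
    refine (linked_of_ne_of_ne hk hσ (q := (fun _ => !(p.1 0), κ)) ?_ hκp.symm).trans
      (linked_of_ne_of_ne hk hσ ?_ hκq)
    · simp
    · simp [h]
  by_cases h : p.1 0 = q.1 0
  · exact key p q h
  · obtain ⟨κ, hκ, -⟩ := exists_ne_ne hk p.2 p.2
    exact (linked_of_ne_of_ne hk hσ (q := (q.1, κ)) h hκ.symm).trans (key _ _ rfl)

/-- The phases relative to the all-zero label do not depend on `T`; they form the diagonal of `D`,
and the entry of `T` at that label is the factor `c`. -/
theorem exists_unitary_of_mapsTestStates (hk : 2 ≤ k) (hσ : ∀ s, TailZero (σ s)) :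
    ∃ D ∈ Matrix.unitaryGroup (AD n k) ℂ, ∀ T, MapsTestStates σ T → ∃ c : ℂ, T = c • D := by
  choose d hd hT using fun p => linked hk hσ p (fun _ => false, fun _ => false)
  refine ⟨Matrix.diagonal d, ?_, fun T hTs => ⟨T (fun _ => false, fun _ => false)
    (fun _ => false, fun _ => false), ?_⟩⟩
  · rw [Matrix.mem_unitaryGroup_iff', Matrix.star_eq_conjTranspose,
      Matrix.diagonal_conjTranspose, Matrix.diagonal_mul_diagonal, ← Matrix.diagonal_one]
    congr 1
    exact funext hd
  · ext p q
    by_cases h : p = q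
    · subst h
      rw [hT p T hTs]
      simp [mul_comm]
    · simp [hTs.isDiag hk hσ h, h]

end Rigidity

/-! ### Factorizing super-operators whose blocks are multiples of one unitary. -/

section Channels

theorem isSuperOperator_of_fintype {H ι : Type*} [Fintype H] [DecidableEq H] [Fintype ι]
    {Φ : Matrix H H ℂ →ₗ[ℂ] Matrix H H ℂ} {K : ι → Matrix H H ℂ} (hK : ∑ j, (K j)ᴴ * K j = 1)
    (hΦ : ∀ ρ, Φ ρ = ∑ j, K j * ρ * (K j)ᴴ) : IsSuperOperator Φ := by
  let e := (Fintype.equivFin ι).symm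
  refine ⟨Fintype.card ι, K ∘ e, ?_, fun ρ => ?_⟩
  · rw [← hK]
    exact Equiv.sum_comp e fun j => (K j)ᴴ * K j
  · rw [hΦ]
    exact (Equiv.sum_comp e fun j => K j * ρ * (K j)ᴴ).symm

/-- The super-operator with operator-sum representation `K`. -/
noncomputable def krausMap {H ι : Type*} [Fintype H] [Fintype ι] (K : ι → Matrix H H ℂ) :
    Matrix H H ℂ →ₗ[ℂ] Matrix H H ℂ where
  toFun ρ := ∑ j, K j * ρ * (K j)ᴴ
  map_add' ρ τ := by simp only [mul_add, add_mul, Finset.sum_add_distrib]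
  map_smul' c ρ := by simp [Finset.smul_sum]

/-- The channel that discards its input and prepares `∑ j, |c j⟩⟨c j|`. -/
theorem exists_preparationChannel {G ι : Type*} [Fintype G] [DecidableEq G] [Fintype ι]
    {c : ι → G → ℂ} (hc : ∑ j, ∑ g, star (c j g) * c j g = 1) :
    ∃ F : Matrix G G ℂ →ₗ[ℂ] Matrix G G ℂ, IsSuperOperator F ∧
      ∀ θ, IsUnitVector θ → F (pureState θ) = ∑ j, pureState (c j) := by
  -- The Kraus operators `|c j⟩⟨h|`: measure in the basis, then prepare.
  let K : ι × G → Matrix G G ℂ := fun t => Matrix.vecMulVec (c t.1) (Pi.single t.2 1)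
  refine ⟨krausMap K, isSuperOperator_of_fintype (K := K) ?_ fun ρ => rfl, fun θ hθ => ?_⟩
  · have h1 : ∀ j h, (K (j, h))ᴴ * K (j, h) =
        (star (c j) ⬝ᵥ c j) • Matrix.single h h (1 : ℂ) := by
      intro j h
      simp only [K, Matrix.conjTranspose_vecMulVec, Matrix.vecMulVec_mul_vecMulVec]
      ext a b
      by_cases ha : h = a <;> by_cases hb : h = b <;>
        simp [Matrix.vecMulVec_apply, Matrix.single_apply, Pi.single_apply, ha, hb, eq_comm]
    rw [Fintype.sum_prod_type]
    simp_rw [h1, ← Finset.smul_sum, Matrix.sum_single_one, ← Finset.sum_smul]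
    have : ∑ j, star (c j) ⬝ᵥ c j = 1 := hc
    rw [this, one_smul]
  · have h1 : ∀ j h, K (j, h) * pureState θ * (K (j, h))ᴴ = (star (θ h) * θ h) • pureState (c j) := by
      intro j h
      simp only [K, pureState, Matrix.conjTranspose_vecMulVec, Matrix.vecMulVec_mul_vecMulVec]
      ext a b
      simp [Matrix.vecMulVec_apply, mul_comm, mul_left_comm]
    have h2 : ∑ h, star (θ h) * θ h = 1 := hθ
    change ∑ t, K t * pureState θ * (K t)ᴴ = _
    rw [Fintype.sum_prod_type]
    simp_rw [h1, ← Finset.sum_smul, h2, one_smul]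

variable {A G : Type*} [Fintype A] [DecidableEq A] [Nonempty A] [Fintype G] [DecidableEq G]
  {r : ℕ} {K : Fin r → Matrix (A × G) (A × G) ℂ}
  {E : Matrix (A × G) (A × G) ℂ →ₗ[ℂ] Matrix (A × G) (A × G) ℂ} {D : Matrix A A ℂ}

/-- Only the value at `θ` is constrained, so the ancilla channel may discard its input and prepare
the state given by the coefficients. Completeness of the blocks and `D† D = 1` normalize it. -/
theorem exists_channel_of_ancillaBlock_eq_smul (hK : ∑ j, (K j)ᴴ * K j = 1)
    (hE : ∀ ρ, E ρ = ∑ j, K j * ρ * (K j)ᴴ) (hD : D ∈ Matrix.unitaryGroup A ℂ)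
    {θ : G → ℂ} (hθ : IsUnitVector θ) (h : ∀ j g, ∃ c : ℂ, ancillaBlock (K j) θ g = c • D) :
    ∃ F : Matrix G G ℂ →ₗ[ℂ] Matrix G G ℂ, IsSuperOperator F ∧
      ∀ ρ, E (ρ ⊗ₖ pureState θ) = (D * ρ * Dᴴ) ⊗ₖ F (pureState θ) := by
  choose c hc using h
  have hD' : Dᴴ * D = 1 := Matrix.mem_unitaryGroup_iff'.1 hD
  have h1 : ∑ j, ∑ g, star (c j g) * c j g = 1 := by
    have h2 := sum_conjTranspose_ancillaBlock_mul hK hθ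
    simp only [hc, Matrix.conjTranspose_smul, Matrix.smul_mul, Matrix.mul_smul, smul_smul, hD',
      ← Finset.sum_smul] at h2
    obtain ⟨p⟩ := ‹Nonempty A›
    simpa only [Matrix.smul_apply, Matrix.one_apply_eq, smul_eq_mul, mul_one, mul_comm (star _)]
      using congrFun (congrFun h2 p) p
  obtain ⟨F, hF, hF'⟩ := exists_preparationChannel h1
  refine ⟨F, hF, fun ρ => ?_⟩
  ext ⟨p, g⟩ ⟨q, h⟩
  rw [superOperator_apply_kronecker hE, hF' θ hθ, Matrix.kroneckerMap_apply, Matrix.sum_apply,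
    Finset.mul_sum]
  refine Finset.sum_congr rfl fun j _ => ?_
  simp only [hc, Matrix.conjTranspose_smul, Matrix.smul_mul, Matrix.mul_smul, Matrix.smul_apply,
    pureState, Matrix.vecMulVec_apply, Pi.star_apply, smul_eq_mul]
  ring

/-- The blocks at basis ancilla states are the submatrices of `K j`, so `K j = D ⊗ C j`, and the `C
j` are the Kraus operators of the ancilla channel. -/
theorem exists_channel_of_forall_ancillaBlock_eq_smul (hK : ∑ j, (K j)ᴴ * K j = 1)
    (hE : ∀ ρ, E ρ = ∑ j, K j * ρ * (K j)ᴴ) (hD : D ∈ Matrix.unitaryGroup A ℂ)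
    (h : ∀ θ : G → ℂ, IsUnitVector θ → ∀ j g, ∃ c : ℂ, ancillaBlock (K j) θ g = c • D) :
    ∃ F : Matrix G G ℂ →ₗ[ℂ] Matrix G G ℂ, IsSuperOperator F ∧
      ∀ ρ τ, E (ρ ⊗ₖ τ) = (D * ρ * Dᴴ) ⊗ₖ F τ := by
  choose c hc using fun h' : G => h _ (isUnitVector_single h')
  let C : Fin r → Matrix G G ℂ := fun j => Matrix.of fun g h' => c h' j g
  have hD' : Dᴴ * D = 1 := Matrix.mem_unitaryGroup_iff'.1 hD
  have hKC : ∀ j, K j = D ⊗ₖ C j := by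
    intro j
    ext ⟨p, g⟩ ⟨q, h'⟩
    rw [← ancillaBlock_single (K j) g h' p q, hc]
    simp [C, mul_comm]
  refine ⟨krausMap C, isSuperOperator_of_fintype (K := C) ?_ fun ρ => rfl, fun ρ τ => ?_⟩
  · simp only [hKC, Matrix.conjTranspose_kronecker, ← Matrix.mul_kronecker_mul, hD'] at hK
    obtain ⟨p⟩ := ‹Nonempty A›
    ext g h'
    have h2 := congrFun (congrFun hK (p, g)) (p, h')
    simp only [Matrix.sum_apply, Matrix.kroneckerMap_apply, Matrix.one_apply_eq, one_mul] at h2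
    rw [Matrix.sum_apply, h2]
    simp [Matrix.one_apply]
  · rw [hE]
    simp only [hKC, Matrix.conjTranspose_kronecker, ← Matrix.mul_kronecker_mul]
    ext ⟨p, g⟩ ⟨q, h'⟩
    simp [krausMap, Matrix.sum_apply, Finset.mul_sum]

theorem exists_ancillaBlock_ne_zero (hK : ∑ j, (K j)ᴴ * K j = 1) {θ : G → ℂ}
    (hθ : IsUnitVector θ) : ∃ j g, ancillaBlock (K j) θ g ≠ 0 := by
  by_contra! h
  have h2 := sum_conjTranspose_ancillaBlock_mul hK hθ
  simp only [h, mul_zero, Finset.sum_const_zero] at h2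
  exact zero_ne_one h2

/-- A nonzero common multiple forces proportionality. -/
theorem exists_eq_smul_trans {V ι κ : Type*} [AddCommGroup V] [Module ℂ V] {D D' : V}
    {T : ι → κ → V} (hT : ∃ j g, T j g ≠ 0) (h : ∀ j g, ∃ c : ℂ, T j g = c • D)
    (h' : ∀ j g, ∃ c : ℂ, T j g = c • D') : ∃ c : ℂ, D' = c • D := by
  obtain ⟨j, g, hjg⟩ := hT
  obtain ⟨c, hc⟩ := h j g
  obtain ⟨c', hc'⟩ := h' j g
  have h0 : c' ≠ 0 := by
    rintro rfl
    exact hjg (by rw [hc', zero_smul])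
  exact ⟨c'⁻¹ * c, by rw [mul_smul, ← hc, hc', inv_smul_smul₀ h0]⟩

end Channels

/-! ### Assembly of both statements. -/

theorem mainTheorem1 (n k : ℕ) [NeZero n] (hk : 2 ≤ k)
    {G₁ G₂ : Type*} [Fintype G₁] [DecidableEq G₁] [Nonempty G₁]
    [Fintype G₂] [DecidableEq G₂] [Nonempty G₂]
    (E₁ : Matrix (QTest.AD n k × G₁) (QTest.AD n k × G₁) ℂ →ₗ[ℂ]
      Matrix (QTest.AD n k × G₁) (QTest.AD n k × G₁) ℂ)
    (E₂ : Matrix (QTest.AD n k × G₂) (QTest.AD n k × G₂) ℂ →ₗ[ℂ]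
      Matrix (QTest.AD n k × G₂) (QTest.AD n k × G₂) ℂ)
    (hE₁ : QTest.IsSuperOperator E₁) (hE₂ : QTest.IsSuperOperator E₂) :
    (∀ (θ₁ : G₁ → ℂ) (θ₂ : G₂ → ℂ), QTest.IsUnitVector θ₁ → QTest.IsUnitVector θ₂ →
      QTest.passProbability E₁ θ₁ E₂ θ₂ = 1 →
      ∃ U ∈ Matrix.unitaryGroup (QTest.AD n k) ℂ,
        ∃ F₁ : Matrix G₁ G₁ ℂ →ₗ[ℂ] Matrix G₁ G₁ ℂ,
        ∃ F₂ : Matrix G₂ G₂ ℂ →ₗ[ℂ] Matrix G₂ G₂ ℂ,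
          QTest.IsSuperOperator F₁ ∧ QTest.IsSuperOperator F₂ ∧
          (∀ ρ : Matrix (QTest.AD n k) (QTest.AD n k) ℂ,
            E₁ (ρ ⊗ₖ QTest.pureState θ₁) = (U * ρ * Uᴴ) ⊗ₖ F₁ (QTest.pureState θ₁)) ∧
          (∀ ρ : Matrix (QTest.AD n k) (QTest.AD n k) ℂ,
            E₂ (ρ ⊗ₖ QTest.pureState θ₂) = (U * ρ * Uᴴ) ⊗ₖ F₂ (QTest.pureState θ₂))) ∧
    ((∀ (θ₁ : G₁ → ℂ) (θ₂ : G₂ → ℂ), QTest.IsUnitVector θ₁ → QTest.IsUnitVector θ₂ →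
        QTest.passProbability E₁ θ₁ E₂ θ₂ = 1) →
      ∃ U ∈ Matrix.unitaryGroup (QTest.AD n k) ℂ,
        ∃ F₁ : Matrix G₁ G₁ ℂ →ₗ[ℂ] Matrix G₁ G₁ ℂ,
        ∃ F₂ : Matrix G₂ G₂ ℂ →ₗ[ℂ] Matrix G₂ G₂ ℂ,
          QTest.IsSuperOperator F₁ ∧ QTest.IsSuperOperator F₂ ∧
          (∀ (ρ : Matrix (QTest.AD n k) (QTest.AD n k) ℂ) (σ : Matrix G₁ G₁ ℂ),
            E₁ (ρ ⊗ₖ σ) = (U * ρ * Uᴴ) ⊗ₖ F₁ σ) ∧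
          (∀ (ρ : Matrix (QTest.AD n k) (QTest.AD n k) ℂ) (σ : Matrix G₂ G₂ ℂ),
            E₂ (ρ ⊗ₖ σ) = (U * ρ * Uᴴ) ⊗ₖ F₂ σ)) := by

  obtain ⟨r₁, K₁, hK₁, hE₁⟩ := hE₁
  obtain ⟨r₂, K₂, hK₂, hE₂⟩ := hE₂
  have key : ∀ (θ₁ : G₁ → ℂ) (θ₂ : G₂ → ℂ), IsUnitVector θ₁ → IsUnitVector θ₂ →
      passProbability E₁ θ₁ E₂ θ₂ = 1 → ∃ D ∈ Matrix.unitaryGroup (AD n k) ℂ,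
        (∀ j g, ∃ c : ℂ, ancillaBlock (K₁ j) θ₁ g = c • D) ∧
          ∀ j g, ∃ c : ℂ, ancillaBlock (K₂ j) θ₂ g = c • D := by
    intro θ₁ θ₂ hθ₁ hθ₂ h
    obtain ⟨σ, hσ, h₁, h₂⟩ :=
      exists_mapsTestStates_of_passProbability_eq_one hK₁ hE₁ hK₂ hE₂ hθ₁ hθ₂ h
    obtain ⟨D, hD, hT⟩ := exists_unitary_of_mapsTestStates hk hσ
    exact ⟨D, hD, fun j g => hT _ (h₁ j g), fun j g => hT _ (h₂ j g)⟩
  constructor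
  · intro θ₁ θ₂ hθ₁ hθ₂ h
    obtain ⟨D, hD, h₁, h₂⟩ := key θ₁ θ₂ hθ₁ hθ₂ h
    obtain ⟨F₁, hF₁, hF₁'⟩ := exists_channel_of_ancillaBlock_eq_smul hK₁ hE₁ hD hθ₁ h₁
    obtain ⟨F₂, hF₂, hF₂'⟩ := exists_channel_of_ancillaBlock_eq_smul hK₂ hE₂ hD hθ₂ h₂
    exact ⟨D, hD, F₁, F₂, hF₁, hF₂, hF₁', hF₂'⟩
  · intro h
    -- Basis ancilla states serve as reference points that fix `D`.
    obtain ⟨g₁⟩ := ‹Nonempty G₁›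
    obtain ⟨g₂⟩ := ‹Nonempty G₂›
    have hg₁ := isUnitVector_single g₁
    have hg₂ := isUnitVector_single g₂
    obtain ⟨D, hD, h₁, h₂⟩ := key _ _ hg₁ hg₂ (h _ _ hg₁ hg₂)
    have hall₁ : ∀ θ : G₁ → ℂ, IsUnitVector θ → ∀ j g, ∃ c : ℂ,
        ancillaBlock (K₁ j) θ g = c • D := by
      intro θ hθ j g
      -- A new `θ` could give a new `D'`, but the second copy is unchanged: one of its blocks is
      -- nonzero and a multiple of both, so `D'` is a multiple of `D`.
      obtain ⟨D', -, h₁', h₂'⟩ := key θ _ hθ hg₂ (h _ _ hθ hg₂)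
      obtain ⟨c, hc⟩ := exists_eq_smul_trans (exists_ancillaBlock_ne_zero hK₂ hg₂) h₂ h₂'
      obtain ⟨c', hc'⟩ := h₁' j g
      exact ⟨c' * c, by rw [hc', hc, smul_smul]⟩
    have hall₂ : ∀ θ : G₂ → ℂ, IsUnitVector θ → ∀ j g, ∃ c : ℂ,
        ancillaBlock (K₂ j) θ g = c • D := by
      intro θ hθ j g
      obtain ⟨D', -, h₁', h₂'⟩ := key _ θ hg₁ hθ (h _ _ hg₁ hθ)
      obtain ⟨c, hc⟩ := exists_eq_smul_trans (exists_ancillaBlock_ne_zero hK₁ hg₁) h₁ h₁'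
      obtain ⟨c', hc'⟩ := h₂' j g
      exact ⟨c' * c, by rw [hc', hc, smul_smul]⟩
    obtain ⟨F₁, hF₁, hF₁'⟩ := exists_channel_of_forall_ancillaBlock_eq_smul hK₁ hE₁ hD hall₁
    obtain ⟨F₂, hF₂, hF₂'⟩ := exists_channel_of_forall_ancillaBlock_eq_smul hK₂ hE₂ hD hall₂
    exact ⟨D, hD, F₁, F₂, hF₁, hF₂, hF₁', hF₂'⟩
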